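/- Let $\mathbf u$ be a planar vector field, continuous in a neighbourhood of the origin of $\mathbb R^2$, of the form $$\mathbf u(x,y)=\bigl(\alpha y+\lambda x^k+f(x,y),\ \ \beta x^n-\lambda k\,y\,x^{k-1}+g(x,y)\bigr)$$ near $0$, where $n,k\ge 2$ are integers, $\alpha,\beta,\lambda$ are nonzero real numbers and, as $(x,y)\to 0$, $$f(x,y)=O(|x|^{k+1})+y\,O(|x|)+O(y^2),\qquad g(x,y)=O(|x|^{n+1})+y\,O(|x|^{k})+O(y^2).$$ Consider the assumptions - (S1) $2k>n+1$ and $n$ is even; - (S2) $2k>n+1$, $n$ is odd and $\alpha\beta>0$; - (S3) $2k>n+1$, $n$ is odd and $\alpha\beta<0$; - (S4) $2k=n+1$ and $\lambda^2k+\alpha\beta>0$; - (S6) $2k=n+1$ and $\lambda^2k+\alpha\beta<0$; - (S7) $2k<n+1$. If one of them holds, then $0$ is an isolated zero of $\mathbf u$, and its index $\operatorname{ind}(\mathbf u,0)$, i.e. the degree of the map $\omega\mapsto \mathbf u(r\omega)/|\mathbf u(r\omega)|$ of the unit circle to itself for all sufficiently small $r>0$, is $$\operatorname{ind}(\mathbf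 u,0)=\begin{cases}0,&\text{if (S1) holds},\\-1,&\text{if (S2), (S4) or (S7) holds},\\ 1,&\text{if (S3) or (S6) holds}.\end{cases}$$ -/

import Mathlib

open Filter Topology Asymptotics

/-- The Euclidean plane; `p 0` and `p 1` are the coordinates `x` and `y`. -/
abbrev Plane : Type := EuclideanSpace ℝ (Fin 2)

/-- The point of the unit circle at angle `t`. -/
noncomputable def circlePt (t : ℝ) : Plane := !₂[Real.cos t, Real.sin t]

/-- `φ` restricts to a continuous map of the unit circle to itself of (Brouwer) degree `d`:
it has a continuous lift `θ` to the universal cover which advances by `d` full turns along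
one turn of the circle. -/
def HasCircleDegree (φ : Plane → Plane) (d : ℤ) : Prop :=
  ∃ θ : ℝ → ℝ, Continuous θ ∧ (∀ t, φ (circlePt t) = circlePt (θ t)) ∧
    ∀ t, θ (t + 2 * Real.pi) = θ t + d * (2 * Real.pi)

/-- `x₀` is an isolated zero of the vector field `u`, which is continuous near `x₀`, and the
index of `u` at `x₀` is `d`: on every sufficiently small circle around `x₀` the normalized field
`ω ↦ u (x₀ + r ω) / ‖u (x₀ + r ω)‖` has degree `d` as a map of the unit circle to itself. -/
def HasIndex (u : Plane → Plane) (x₀ : Plane) (d : ℤ) : Prop :=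
  u x₀ = 0 ∧ ∃ R : ℝ, 0 < R ∧ ContinuousOn u (Metric.ball x₀ R) ∧
    (∀ x ∈ Metric.ball x₀ R, u x = 0 → x = x₀) ∧
    ∀ r : ℝ, 0 < r → r < R →
      HasCircleDegree (fun ω => ‖u (x₀ + r • ω)‖⁻¹ • u (x₀ + r • ω)) d

/-- Near the origin, `u (x, y) = (α y + lam x ^ k + f, β x ^ n - lam k y x ^ (k - 1) + g)` with
`f = O(|x| ^ (k + 1)) + y O(|x|) + O(y ^ 2)` and
`g = O(|x| ^ (n + 1)) + y O(|x| ^ k) + O(y ^ 2)` as `(x, y) → 0`. -/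
def HasTaylorForm (u : Plane → Plane) (α β lam : ℝ) (n k : ℕ) : Prop :=
  ∃ f f₁ f₂ f₃ g g₁ g₂ g₃ : Plane → ℝ,
    (∀ᶠ p in 𝓝 (0 : Plane), u p =
      !₂[α * p 1 + lam * p 0 ^ k + f p, β * p 0 ^ n - lam * k * p 1 * p 0 ^ (k - 1) + g p]) ∧
    (∀ᶠ p in 𝓝 (0 : Plane), f p = f₁ p + p 1 * f₂ p + f₃ p) ∧
    (f₁ =O[𝓝 0] fun p => |p 0| ^ (k + 1)) ∧
    (f₂ =O[𝓝 0] fun p => |p 0|) ∧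
    (f₃ =O[𝓝 0] fun p => p 1 ^ 2) ∧
    (∀ᶠ p in 𝓝 (0 : Plane), g p = g₁ p + p 1 * g₂ p + g₃ p) ∧
    (g₁ =O[𝓝 0] fun p => |p 0| ^ (n + 1)) ∧
    (g₂ =O[𝓝 0] fun p => |p 0| ^ k) ∧
    (g₃ =O[𝓝 0] fun p => p 1 ^ 2)

/-- The degree of a self-map of the circle is unique. -/
theorem HasCircleDegree.unique {φ : Plane → Plane} {d e : ℤ}
    (hd : HasCircleDegree φ d) (he : HasCircleDegree φ e) : d = e := by
  obtain ⟨θ, hθ, h1, h2⟩ := hd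
  obtain ⟨η, hη, h3, h4⟩ := he
  have hpi : (0 : ℝ) < 2 * Real.pi := by positivity
  have key : ∀ t, ∃ m : ℤ, (θ t - η t) / (2 * Real.pi) = m := by
    intro t
    have h : circlePt (θ t) = circlePt (η t) := by rw [← h1, ← h3]
    have hc : Real.cos (θ t) = Real.cos (η t) := by
      simpa [circlePt] using congrArg (fun p : Plane => p 0) h
    have hs : Real.sin (θ t) = Real.sin (η t) := by
      simpa [circlePt] using congrArg (fun p : Plane => p 1) h
    obtain ⟨m, hm⟩ := Real.Angle.angle_eq_iff_two_pi_dvd_sub.1 (Real.Angle.cos_sin_inj hc hs)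
    exact ⟨m, by rw [hm]; field_simp⟩
  choose m hm using key
  have hcont : Continuous m := by
    refine Int.isClosedEmbedding_coe_real.isEmbedding.continuous_iff.2 ?_
    have : ((fun z : ℤ => (z : ℝ)) ∘ m) = fun t => (θ t - η t) / (2 * Real.pi) := by
      funext t
      exact (hm t).symm
    rw [this]
    fun_prop
  have hconst : m (0 + 2 * Real.pi) = m 0 :=
    PreconnectedSpace.constant inferInstance hcont
  have e1 := hm (0 + 2 * Real.pi)
  rw [hconst, ← hm 0, h2, h4, div_left_inj' hpi.ne'] at e1
  have e2 : (d : ℝ) * (2 * Real.pi) = e * (2 * Real.pi) := by linarith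
  exact_mod_cast mul_right_cancel₀ hpi.ne' e2

/-- The index is unique. -/
theorem HasIndex.unique {u : Plane → Plane} {x₀ : Plane} {d e : ℤ}
    (hd : HasIndex u x₀ d) (he : HasIndex u x₀ e) : d = e := by
  obtain ⟨-, R, hR, -, -, h⟩ := hd
  obtain ⟨-, S, hS, -, -, h'⟩ := he
  have hm : 0 < min R S := lt_min hR hS
  have h1 := min_le_left R S
  have h2 := min_le_right R S
  exact (h (min R S / 2) (by linarith) (by linarith)).unique
    (h' (min R S / 2) (by linarith) (by linarith))

/-! Only the zero set of the first component `u₁` matters. There `y = -(lam / α) x ^ k + O(|x| ^ (k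
+ 1))`, and substituting into the second component leaves `β x ^ n + (lam ^ 2 k / α) x ^ (2 k - 1)`
plus higher order terms (`HasTaylorForm.exists_bound_of_eq_zero`). Each assumption selects a
dominant term `c x ^ m` with `c ≠ 0`.

If `m` is even, `u` is never opposite to the constant field `(0, c)`, so the index is 0. If `m` is
odd, the second component has the sign of `c x` where `u₁ = 0`; as `u₁` has the sign of `α y` on the
axis `x = 0`, the index is that of `(α y, c x)`, namely minus the sign of `α c`. Both comparisons
rest on `HasWinding.of_not_opposite`. -/

/-! ### Winding numbers of closed curves -/

open Complex in
/-- The nowhere vanishing curve `γ` has a continuous argument which advances by `d` full turns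
along `[t, t + 2 * π]`. -/
def HasWinding (γ : ℝ → ℂ) (d : ℤ) : Prop :=
  ∃ θ : ℝ → ℝ, Continuous θ ∧ (∀ t, γ t ≠ 0 ∧ γ t = ‖γ t‖ * exp (θ t * I)) ∧
    ∀ t, θ (t + 2 * Real.pi) = θ t + d * (2 * Real.pi)

/-- The vector `p` of the plane as a complex number. -/
def Plane.toComplex (p : Plane) : ℂ := ⟨p 0, p 1⟩

theorem continuous_complex_mk {X : Type*} [TopologicalSpace X] {f g : X → ℝ}
    (hf : Continuous f) (hg : Continuous g) : Continuous fun t => (⟨f t, g t⟩ : ℂ) := by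
  have : (fun t => (⟨f t, g t⟩ : ℂ)) = fun t => (f t : ℂ) + (g t : ℂ) * Complex.I := by
    funext t
    apply Complex.ext <;> simp
  rw [this]
  fun_prop

theorem Plane.continuous_toComplex : Continuous Plane.toComplex :=
  continuous_complex_mk (by fun_prop) (by fun_prop)

theorem Plane.norm_toComplex (p : Plane) : ‖p.toComplex‖ = ‖p‖ := by
  rw [EuclideanSpace.norm_eq, Complex.norm_eq_sqrt_sq_add_sq]
  simp [Plane.toComplex]

theorem continuous_circlePt : Continuous circlePt := by
  unfold circlePt
  refine (PiLp.continuous_toLp 2 _).comp (continuous_pi fun i => ?_)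
  fin_cases i
  · exact Real.continuous_cos
  · exact Real.continuous_sin

theorem circlePt_add_two_pi (t : ℝ) : circlePt (t + 2 * Real.pi) = circlePt t := by
  simp [circlePt]

theorem norm_circlePt (t : ℝ) : ‖circlePt t‖ = 1 := by
  simp [EuclideanSpace.norm_eq, circlePt]

/-- Two closed curves which never point in opposite directions have the same winding number. -/
theorem HasWinding.of_not_opposite {γ₀ γ₁ : ℝ → ℂ} {d : ℤ} (h : HasWinding γ₀ d)
    (h₀ : Continuous γ₀) (h₁ : Continuous γ₁)
    (p₀ : ∀ t, γ₀ (t + 2 * Real.pi) = γ₀ t) (p₁ : ∀ t, γ₁ (t + 2 * Real.pi) = γ₁ t)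
    (hne : ∀ t, ∀ q : ℝ, 0 ≤ q → γ₁ t + q * γ₀ t ≠ 0) : HasWinding γ₁ d := by
  obtain ⟨θ, hθ, hpol, hper⟩ := h
  -- A quotient in `(-∞, 0]` would make `γ₁ t + q * γ₀ t` vanish for `q` its negative. Off that ray
  -- the principal argument is continuous, so it can be added to `θ`.
  have hslit : ∀ t, γ₁ t / γ₀ t ∈ Complex.slitPlane := by
    intro t
    rw [Complex.mem_slitPlane_iff_not_le_zero]
    intro hle
    have hz := (hpol t).1
    obtain ⟨hre, him⟩ := Complex.le_def.1 hle
    refine hne t (-(γ₁ t / γ₀ t).re) (by simpa using hre) ?_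
    have : ((γ₁ t / γ₀ t).re : ℂ) = γ₁ t / γ₀ t :=
      Complex.ext (by simp) (by simpa using him.symm)
    rw [Complex.ofReal_neg, this]
    field_simp
    ring
  refine ⟨fun t => θ t + Complex.arg (γ₁ t / γ₀ t), ?_, fun t => ⟨?_, ?_⟩, fun t => ?_⟩
  · refine hθ.add (continuous_iff_continuousAt.2 fun t => ?_)
    exact ContinuousAt.comp (f := fun t => γ₁ t / γ₀ t) (Complex.continuousAt_arg (hslit t))
      (h₁.div h₀ fun t => (hpol t).1).continuousAt
  · simpa using hne t 0 le_rfl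
  · obtain ⟨hz, hp⟩ := hpol t
    have hq := Complex.norm_mul_exp_arg_mul_I (γ₁ t / γ₀ t)
    have hn : (‖γ₀ t‖ : ℂ) ≠ 0 := by simpa using hz
    rw [norm_div, Complex.ofReal_div] at hq
    push_cast
    rw [add_mul, Complex.exp_add]
    calc γ₁ t = γ₀ t * (γ₁ t / γ₀ t) := by field_simp
      _ = (‖γ₀ t‖ * Complex.exp (θ t * Complex.I)) * (‖γ₁ t‖ / ‖γ₀ t‖ *
          Complex.exp (Complex.arg (γ₁ t / γ₀ t) * Complex.I)) := by rw [hq, ← hp]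
      _ = _ := by field_simp
  · simp only [p₀, p₁, hper]
    ring

theorem hasWinding_exp (d : ℤ) (φ : ℝ) :
    HasWinding (fun t => Complex.exp ((d * t + φ : ℝ) * Complex.I)) d := by
  refine ⟨fun t => d * t + φ, by fun_prop, fun t => ⟨Complex.exp_ne_zero _, ?_⟩, fun t => by ring⟩
  simp only [Complex.norm_exp_ofReal_mul_I]
  simp

theorem hasWinding_const {z : ℂ} (hz : z ≠ 0) : HasWinding (fun _ => z) 0 :=
  ⟨fun _ => z.arg, continuous_const, fun _ => ⟨hz, (Complex.norm_mul_exp_arg_mul_I z).symm⟩,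
    by simp⟩

/-- A phase of `±π / 2` turns `exp ((d * t + φ) * I)` into a curve whose two components have the
signs of those of the ellipse, so the two never point in opposite directions. -/
theorem hasWinding_sin_cos {a c : ℝ} {d : ℤ}
    (hd : (0 < a * c ∧ d = -1) ∨ (a * c < 0 ∧ d = 1)) :
    HasWinding (fun t => ⟨a * Real.sin t, c * Real.cos t⟩) d := by
  obtain ⟨φ, σ, τ, hσ, hτ, hc, hs⟩ : ∃ φ σ τ : ℝ, 0 < a * σ ∧ 0 < c * τ ∧
      (∀ t, Real.cos (d * t + φ) = σ * Real.sin t) ∧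
      ∀ t, Real.sin (d * t + φ) = τ * Real.cos t := by
    rcases hd with ⟨h, rfl⟩ | ⟨h, rfl⟩
    · rcases pos_and_pos_or_neg_and_neg_of_mul_pos h with ⟨ha, hc⟩ | ⟨ha, hc⟩
      · exact ⟨Real.pi / 2, 1, 1, by simpa, by simpa, fun t => by simp [Real.cos_add_pi_div_two],
          fun t => by simp [Real.sin_add_pi_div_two]⟩
      · exact ⟨-(Real.pi / 2), -1, -1, by simpa, by simpa,
          fun t => by simp [← sub_eq_add_neg, Real.cos_sub_pi_div_two],
          fun t => by simp [← sub_eq_add_neg, Real.sin_sub_pi_div_two]⟩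
    · rcases mul_neg_iff.1 h with ⟨ha, hc⟩ | ⟨ha, hc⟩
      · exact ⟨-(Real.pi / 2), 1, -1, by simpa, by simpa,
          fun t => by simp [← sub_eq_add_neg, Real.cos_sub_pi_div_two],
          fun t => by simp [← sub_eq_add_neg, Real.sin_sub_pi_div_two]⟩
      · exact ⟨Real.pi / 2, -1, 1, by simpa, by simpa,
          fun t => by simp [Real.cos_add_pi_div_two], fun t => by simp [Real.sin_add_pi_div_two]⟩
  refine (hasWinding_exp d φ).of_not_opposite (by fun_prop)
    (continuous_complex_mk (by fun_prop) (by fun_prop)) (fun t => ?_) (fun t => by simp)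
    fun t q hq h => ?_
  · rw [Complex.exp_eq_exp_iff_exists_int]
    exact ⟨d, by push_cast; ring⟩
  · rw [Complex.ext_iff] at h
    obtain ⟨h1, h2⟩ := h
    simp only [Complex.add_re, Complex.add_im, Complex.re_ofReal_mul, Complex.im_ofReal_mul,
      Complex.exp_ofReal_mul_I_re, Complex.exp_ofReal_mul_I_im, Complex.zero_re,
      Complex.zero_im] at h1 h2
    rw [hc] at h1
    rw [hs] at h2
    have e : (a * σ + q * σ ^ 2) * (Real.sin t) ^ 2 = 0 := by linear_combination σ * Real.sin t * h1
    have e' : (c * τ + q * τ ^ 2) * (Real.cos t) ^ 2 = 0 := by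
      linear_combination τ * Real.cos t * h2
    have hs0 : Real.sin t ^ 2 = 0 := (mul_eq_zero.1 e).resolve_left (by positivity)
    have hc0 : Real.cos t ^ 2 = 0 := (mul_eq_zero.1 e').resolve_left (by positivity)
    have := Real.sin_sq_add_cos_sq t
    rw [hs0, hc0] at this
    norm_num at this

/-! ### From winding numbers to the index -/

/-- The degree of the normalized field is the winding number of the field along the circle. -/
theorem HasWinding.hasCircleDegree {v : Plane → Plane} {d : ℤ}
    (h : HasWinding (fun t => (v (circlePt t)).toComplex) d) :
    HasCircleDegree (fun ω => ‖v ω‖⁻¹ • v ω) d := by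
  obtain ⟨θ, hθ, hpol, hper⟩ := h
  refine ⟨θ, hθ, fun t => ?_, hper⟩
  obtain ⟨hne, hp⟩ := hpol t
  rw [Plane.norm_toComplex] at hp
  have hn : ‖v (circlePt t)‖ ≠ 0 := by
    rw [← Plane.norm_toComplex]
    simpa using hne
  have h0 : v (circlePt t) 0 = ‖v (circlePt t)‖ * Real.cos (θ t) := by
    have := congrArg Complex.re hp
    rwa [Complex.re_ofReal_mul, Complex.exp_ofReal_mul_I_re] at this
  have h1 : v (circlePt t) 1 = ‖v (circlePt t)‖ * Real.sin (θ t) := by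
    have := congrArg Complex.im hp
    rwa [Complex.im_ofReal_mul, Complex.exp_ofReal_mul_I_im] at this
  ext i
  fin_cases i
  · simp only [circlePt, Fin.zero_eta, PiLp.smul_apply, smul_eq_mul] at h0 hn ⊢
    rw [h0, inv_mul_cancel_left₀ hn]
    simp
  · simp only [circlePt, Fin.mk_one, PiLp.smul_apply, smul_eq_mul] at h1 hn ⊢
    rw [h1, inv_mul_cancel_left₀ hn]
    simp

theorem Plane.eq_zero {p : Plane} (h0 : p 0 = 0) (h1 : p 1 = 0) : p = 0 := by
  ext i
  fin_cases i
  · exact h0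
  · exact h1

/-- The index is the winding number of the field along all small circles. -/
theorem hasIndex_of_hasWinding {u : Plane → Plane} {d : ℤ}
    (hcont : ∀ᶠ p in 𝓝 (0 : Plane), ContinuousAt u p) (h0 : u 0 = 0) {P : Plane → Prop}
    (hP : ∀ᶠ p in 𝓝 (0 : Plane), p ≠ 0 → P p) (hne : ∀ p, P p → u p ≠ 0)
    (hw : ∀ r : ℝ, 0 < r → Continuous (fun t => u (r • circlePt t)) →
      (∀ t, P (r • circlePt t)) → HasWinding (fun t => (u (r • circlePt t)).toComplex) d) :
    HasIndex u 0 d := by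
  obtain ⟨R, hR, h⟩ := Metric.eventually_nhds_iff_ball.1 (hcont.and hP)
  refine ⟨h0, R, hR, fun p hp => (h p hp).1.continuousWithinAt, fun p hp hup => ?_,
    fun r hr hrR => ?_⟩
  · by_contra hp0
    exact hne p ((h p hp).2 hp0) hup
  · have hmem : ∀ t, r • circlePt t ∈ Metric.ball (0 : Plane) R := fun t => by
      simpa [norm_smul, norm_circlePt, abs_of_pos hr] using hrR
    have hc : ∀ t, circlePt t ≠ 0 := fun t => by
      rw [← norm_ne_zero_iff, norm_circlePt]
      exact one_ne_zero
    refine HasWinding.hasCircleDegree (v := fun ω => u (0 + r • ω)) ?_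
    simp only [zero_add]
    refine hw r hr (continuous_iff_continuousAt.2 fun t => ?_) fun t =>
      (h _ (hmem t)).2 (smul_ne_zero hr.ne' (hc t))
    exact ContinuousAt.comp (f := fun t => r • circlePt t) (h _ (hmem t)).1
      (continuous_circlePt.const_smul r).continuousAt

/-! ### Index from sign conditions -/

/-- A field whose second component has a fixed sign where the first one vanishes has index
zero. -/
theorem hasIndex_zero_of_sign {u : Plane → Plane} {c : ℝ} (hc0 : c ≠ 0)
    (hcont : ∀ᶠ p in 𝓝 (0 : Plane), ContinuousAt u p) (h0 : u 0 = 0)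
    (hc : ∀ᶠ p in 𝓝 (0 : Plane), p ≠ 0 → u p 0 = 0 → 0 < c * u p 1) : HasIndex u 0 0 := by
  refine hasIndex_of_hasWinding hcont h0 hc (fun p hp hup => ?_) fun r hr hur hP => ?_
  · have := hp (by simp [hup])
    simp [hup] at this
  · refine (hasWinding_const (z := ⟨0, c⟩) fun h => hc0 (congrArg Complex.im h)).of_not_opposite
      continuous_const (Plane.continuous_toComplex.comp hur) (fun _ => rfl)
      (fun t => by rw [circlePt_add_two_pi]) fun t q hq h => ?_
    rw [Complex.ext_iff] at h
    simp only [Plane.toComplex, Complex.add_re, Complex.add_im, Complex.re_ofReal_mul,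
      Complex.im_ofReal_mul, Complex.zero_re, Complex.zero_im, mul_zero, add_zero] at h
    have h1 := hP t h.1
    have h2 : c * u (r • circlePt t) 1 + q * c ^ 2 = 0 := by linear_combination c * h.2
    nlinarith [mul_nonneg hq (sq_nonneg c)]

/-- A field whose second component has the sign of `c * x` where the first one vanishes, and
whose first component has the sign of `a * y` on the axis `x = 0`, has the index of the linear
field `(a * y, c * x)`. -/
theorem hasIndex_of_sign {u : Plane → Plane} {a c : ℝ} {d : ℤ}
    (hcont : ∀ᶠ p in 𝓝 (0 : Plane), ContinuousAt u p) (h0 : u 0 = 0)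
    (hc : ∀ᶠ p in 𝓝 (0 : Plane), p ≠ 0 → u p 0 = 0 → 0 < c * p 0 * u p 1)
    (ha : ∀ᶠ p in 𝓝 (0 : Plane), p ≠ 0 → p 0 = 0 → 0 < a * p 1 * u p 0)
    (hd : (0 < a * c ∧ d = -1) ∨ (a * c < 0 ∧ d = 1)) : HasIndex u 0 d := by
  have hP : ∀ᶠ p in 𝓝 (0 : Plane), p ≠ 0 →
      (u p 0 = 0 → 0 < c * p 0 * u p 1) ∧ (p 0 = 0 → 0 < a * p 1 * u p 0) := by
    filter_upwards [hc, ha] with p h1 h2 hp using ⟨h1 hp, h2 hp⟩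
  have hc0 : c ≠ 0 := by
    rintro rfl
    simp at hd
  refine hasIndex_of_hasWinding hcont h0 hP (fun p hp hup => ?_) fun r hr hur hP => ?_
  · have := hp.1 (by simp [hup])
    simp [hup] at this
  have hx : ∀ t, (r • circlePt t) 0 = r * Real.cos t := fun t => by simp [circlePt]
  have hy : ∀ t, (r • circlePt t) 1 = r * Real.sin t := fun t => by simp [circlePt]
  -- The intermediate field `(u₁, c x)` shares one component with each end, so opposition to either
  -- end forces the shared component to vanish, where a sign hypothesis applies.
  have hmid : Continuous fun t => (⟨u (r • circlePt t) 0, c * Real.cos t⟩ : ℂ) :=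
    continuous_complex_mk ((PiLp.continuous_apply 2 _ 0).comp hur)
      (Real.continuous_cos.const_mul c)
  have hw : HasWinding (fun t => ⟨u (r • circlePt t) 0, c * Real.cos t⟩) d := by
    refine (hasWinding_sin_cos hd).of_not_opposite
      (continuous_complex_mk (by fun_prop) (by fun_prop)) hmid (fun t => by simp)
      (fun t => by simp [circlePt_add_two_pi]) fun t q hq h => ?_
    rw [Complex.ext_iff] at h
    simp only [Complex.add_re, Complex.add_im, Complex.re_ofReal_mul,
      Complex.im_ofReal_mul, Complex.zero_re, Complex.zero_im] at h
    obtain ⟨h1, h2⟩ := h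
    have hcos : Real.cos t = 0 := by
      have : (1 + q) * c * Real.cos t = 0 := by linarith
      have hq1 : 1 + q ≠ 0 := by positivity
      simpa [hq1, hc0] using this
    have := (hP t).2 (by rw [hx, hcos, mul_zero])
    rw [hy] at this
    have h3 : 0 < r * (a * Real.sin t * u (r • circlePt t) 0) := by linarith
    have h4 := pos_of_mul_pos_right h3 hr.le
    have h5 : a * Real.sin t * u (r • circlePt t) 0 + q * (a * Real.sin t) ^ 2 = 0 := by
      linear_combination a * Real.sin t * h1
    nlinarith [mul_nonneg hq (sq_nonneg (a * Real.sin t))]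
  refine hw.of_not_opposite hmid (Plane.continuous_toComplex.comp hur)
    (fun t => by simp [circlePt_add_two_pi]) (fun t => by simp [circlePt_add_two_pi])
    fun t q hq h => ?_
  rw [Complex.ext_iff] at h
  simp only [Plane.toComplex, Complex.add_re, Complex.add_im, Complex.re_ofReal_mul,
    Complex.im_ofReal_mul, Complex.zero_re, Complex.zero_im] at h
  obtain ⟨h1, h2⟩ := h
  have hu : u (r • circlePt t) 0 = 0 := by
    have : (1 + q) * u (r • circlePt t) 0 = 0 := by linarith
    have hq1 : 1 + q ≠ 0 := by positivity
    simpa [hq1] using this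
  have := (hP t).1 hu
  rw [hx] at this
  have h3 : 0 < r * (c * Real.cos t * u (r • circlePt t) 1) := by linarith
  have h4 := pos_of_mul_pos_right h3 hr.le
  have h5 : c * Real.cos t * u (r • circlePt t) 1 + q * (c * Real.cos t) ^ 2 = 0 := by
    linear_combination c * Real.cos t * h2
  nlinarith [mul_nonneg hq (sq_nonneg (c * Real.cos t))]

/-! ### Estimates from the Taylor form -/

theorem HasTaylorForm.exists_bound {u : Plane → Plane} {α β lam : ℝ} {n k : ℕ}
    (hu : HasTaylorForm u α β lam n k) :
    ∃ C : ℝ, 0 < C ∧ ∀ᶠ p in 𝓝 (0 : Plane),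
      |u p 0 - (α * p 1 + lam * p 0 ^ k)| ≤
        C * (|p 0| ^ (k + 1) + |p 1| * |p 0| + |p 1| ^ 2) ∧
      |u p 1 - (β * p 0 ^ n - lam * k * p 1 * p 0 ^ (k - 1))| ≤
        C * (|p 0| ^ (n + 1) + |p 1| * |p 0| ^ k + |p 1| ^ 2) := by
  have hsum : ∀ {C x₁ x₂ x₃ y a b c C₁ C₂ C₃ : ℝ}, |x₁| ≤ C₁ * a → |x₂| ≤ C₂ * b →
      |x₃| ≤ C₃ * c → C₁ ≤ C → C₂ ≤ C → C₃ ≤ C → 0 ≤ a → 0 ≤ b → 0 ≤ c →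
      |x₁ + y * x₂ + x₃| ≤ C * (a + |y| * b + c) := by
    intro C x₁ x₂ x₃ y a b c C₁ C₂ C₃ h₁ h₂ h₃ i₁ i₂ i₃ ha hb hc
    calc |x₁ + y * x₂ + x₃| ≤ |x₁| + |y| * |x₂| + |x₃| := by
          rw [← abs_mul]
          exact abs_add_three _ _ _
      _ ≤ C * a + |y| * (C * b) + C * c := by
          gcongr
          · exact h₁.trans (by gcongr)
          · exact h₂.trans (by gcongr)
          · exact h₃.trans (by gcongr)
      _ = _ := by ring
  obtain ⟨f, f₁, f₂, f₃, g, g₁, g₂, g₃, hu, hf, hf₁, hf₂, hf₃, hg, hg₁, hg₂, hg₃⟩ := hu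
  obtain ⟨A₁, hA₁, a₁⟩ := hf₁.exists_pos
  obtain ⟨A₂, hA₂, a₂⟩ := hf₂.exists_pos
  obtain ⟨A₃, hA₃, a₃⟩ := hf₃.exists_pos
  obtain ⟨B₁, hB₁, b₁⟩ := hg₁.exists_pos
  obtain ⟨B₂, hB₂, b₂⟩ := hg₂.exists_pos
  obtain ⟨B₃, hB₃, b₃⟩ := hg₃.exists_pos
  refine ⟨A₁ + A₂ + A₃ + B₁ + B₂ + B₃, by positivity, ?_⟩
  filter_upwards [hu, hf, hg, a₁.bound, a₂.bound, a₃.bound, b₁.bound, b₂.bound, b₃.bound]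
    with p hu hf hg a₁ a₂ a₃ b₁ b₂ b₃
  simp only [Real.norm_eq_abs, abs_pow, abs_abs] at a₁ a₂ a₃ b₁ b₂ b₃
  constructor
  · have : u p 0 - (α * p 1 + lam * p 0 ^ k) = f₁ p + p 1 * f₂ p + f₃ p := by
      rw [hu, ← hf]
      simp
    rw [this]
    exact hsum a₁ a₂ a₃ (by linarith) (by linarith) (by linarith) (by positivity) (by positivity)
      (by positivity)
  · have : u p 1 - (β * p 0 ^ n - lam * k * p 1 * p 0 ^ (k - 1)) =
        g₁ p + p 1 * g₂ p + g₃ p := by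
      rw [hu, ← hg]
      simp
    rw [this]
    exact hsum b₁ b₂ b₃ (by linarith) (by linarith) (by linarith) (by positivity) (by positivity)
      (by positivity)

theorem Plane.eventually_abs_lt {ε : ℝ} (hε : 0 < ε) :
    ∀ᶠ p in 𝓝 (0 : Plane), |p 0| < ε ∧ |p 1| < ε := by
  have h : ∀ i : Fin 2, ∀ᶠ p in 𝓝 (0 : Plane), |p i| < ε := fun i => by
    have hc : Continuous fun p : Plane => |p i| := by fun_prop
    exact hc.continuousAt.eventually_lt continuousAt_const (by simpa using hε)
  exact (h 0).and (h 1)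

theorem HasTaylorForm.map_zero {u : Plane → Plane} {α β lam : ℝ} {n k : ℕ}
    (hu : HasTaylorForm u α β lam n k) (hn : n ≠ 0) (hk : k ≠ 0) : u 0 = 0 := by
  obtain ⟨C, -, h⟩ := hu.exists_bound
  have := h.self_of_nhds
  simp [hn, hk] at this
  exact Plane.eq_zero this.1 this.2

/-- On the axis `x = 0` the first component has the sign of `α * y`. -/
theorem HasTaylorForm.sign_on_axis {u : Plane → Plane} {α β lam : ℝ} {n k : ℕ}
    (hu : HasTaylorForm u α β lam n k) (hα : α ≠ 0) (hk : k ≠ 0) :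
    ∀ᶠ p in 𝓝 (0 : Plane), p ≠ 0 → p 0 = 0 → 0 < α * p 1 * u p 0 := by
  obtain ⟨C, hC, h⟩ := hu.exists_bound
  have hα' := abs_pos.2 hα
  filter_upwards [h, Plane.eventually_abs_lt (ε := |α| / C) (by positivity)] with p hp hsm hp0 hx
  have hy : 0 < |p 1| := abs_pos.2 fun hy => hp0 (Plane.eq_zero hx hy)
  have h1 := hp.1
  simp only [hx, zero_pow hk, abs_zero, zero_pow k.succ_ne_zero, mul_zero, add_zero,
    zero_add] at h1
  have h2 : C * |p 1| < |α| := by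
    have := (lt_div_iff₀ hC).1 hsm.2
    linarith
  have h3 : |u p 0 - α * p 1| < |α * p 1| := by
    rw [abs_mul]
    nlinarith
  -- Expanding the squares gives `u₁ ^ 2 < 2 * (α * y) * u₁`.
  have h4 := sq_lt_sq.2 h3
  nlinarith [sq_nonneg (u p 0)]

/-- Along the zero set of the first component `y = O(|x| ^ k)`, and the second component is
`β * x ^ n + (lam ^ 2 * k / α) * x ^ (2 * k - 1)` up to higher order terms. -/
theorem HasTaylorForm.exists_bound_of_eq_zero {u : Plane → Plane} {α β lam : ℝ} {n k : ℕ}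
    (hu : HasTaylorForm u α β lam n k) (hα : α ≠ 0) (hk : 1 ≤ k) :
    ∃ K : ℝ, 0 < K ∧ ∀ᶠ p in 𝓝 (0 : Plane), u p 0 = 0 →
      |p 1| ≤ K * |p 0| ^ k ∧
      |u p 1 - (β * p 0 ^ n + lam ^ 2 * k / α * p 0 ^ (2 * k - 1))| ≤
        K * (|p 0| ^ (n + 1) + |p 0| ^ (2 * k)) := by
  obtain ⟨C, hC, h⟩ := hu.exists_bound
  have hα' := abs_pos.2 hα
  -- `M` bounds `|y| / |x| ^ k`: with `|x|, |y| < |α| / (4 * C)`, the two error terms containing `y`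
  -- absorb at most half of `|α| * |y|`, whence the factor 2.
  obtain ⟨M, hM⟩ : ∃ M, M = 2 * (|lam| + C) / |α| := ⟨_, rfl⟩
  have hM0 : 0 < M := by rw [hM]; positivity
  obtain ⟨L, hL⟩ : ∃ L, L = C * (1 + M + M ^ 2) / |α| := ⟨_, rfl⟩
  have hL0 : 0 < L := by rw [hL]; positivity
  refine ⟨M + C * (1 + M + M ^ 2) + |lam| * k * L, by positivity, ?_⟩
  filter_upwards [h, Plane.eventually_abs_lt (ε := min 1 (|α| / (4 * C))) (by positivity)]
    with p hp hsm hu0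
  rw [hu0, zero_sub, abs_neg] at hp
  obtain ⟨h1, h2⟩ := hp
  obtain ⟨⟨hx1, hx2⟩, hy1, hy2⟩ : (|p 0| < 1 ∧ |p 0| < |α| / (4 * C)) ∧
    |p 1| < 1 ∧ |p 1| < |α| / (4 * C) := ⟨lt_min_iff.1 hsm.1, lt_min_iff.1 hsm.2⟩
  generalize u p 1 = v at *
  generalize p 0 = x at *
  generalize p 1 = y at *
  clear hsm hu0 h hu
  rw [lt_div_iff₀ (by positivity)] at hx2 hy2
  have hX := abs_nonneg x
  have hY := abs_nonneg y
  have hpow : |x| ^ (k + 1) ≤ |x| ^ k := pow_le_pow_of_le_one hX hx1.le k.le_succ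
  have hy : |y| ≤ M * |x| ^ k := by
    have e1 : |α| * |y| ≤ |α * y + lam * x ^ k| + |lam| * |x| ^ k := by
      rw [← abs_mul, ← abs_pow, ← abs_mul]
      have := abs_sub (α * y + lam * x ^ k) (lam * x ^ k)
      rwa [add_sub_cancel_right] at this
    have e2 : C * (|y| * |x|) ≤ |α| / 4 * |y| := by nlinarith
    have e3 : C * |y| ^ 2 ≤ |α| / 4 * |y| := by nlinarith
    have e4 : C * |x| ^ (k + 1) ≤ C * |x| ^ k := by gcongr
    rw [hM, div_mul_eq_mul_div, le_div_iff₀ hα']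
    nlinarith
  have hxy : |y| * |x| ≤ M * |x| ^ (k + 1) := by
    calc |y| * |x| ≤ M * |x| ^ k * |x| := by gcongr
      _ = _ := by ring
  have hxy' : |y| * |x| ^ k ≤ M * |x| ^ (2 * k) := by
    calc |y| * |x| ^ k ≤ M * |x| ^ k * |x| ^ k := by gcongr
      _ = _ := by ring
  have hyy : |y| ^ 2 ≤ M ^ 2 * |x| ^ (2 * k) := by
    calc |y| ^ 2 ≤ (M * |x| ^ k) ^ 2 := by gcongr
      _ = _ := by ring
  have hyy' : |y| ^ 2 ≤ M ^ 2 * |x| ^ (k + 1) := by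
    refine hyy.trans ?_
    gcongr ?_ * ?_
    exact pow_le_pow_of_le_one hX hx1.le (by omega)
  have hcoef : 0 ≤ C * (1 + M + M ^ 2) := by positivity
  refine ⟨hy.trans ?_, ?_⟩
  · gcongr
    have : 0 ≤ |lam| * k * L := by positivity
    linarith
  -- The crude bound `|y| ≤ M * |x| ^ k`, fed back into `u₁ = 0`, makes every error term `O(|x| ^ (k
  -- + 1))`.
  have hylin : |y + lam / α * x ^ k| ≤ L * |x| ^ (k + 1) := by
    have e : α * y + lam * x ^ k = α * (y + lam / α * x ^ k) := by field_simp
    rw [e, abs_mul] at h1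
    rw [hL, div_mul_eq_mul_div (C * (1 + M + M ^ 2)), le_div_iff₀ hα']
    nlinarith
  have hkk : x ^ (k - 1) * x ^ k = x ^ (2 * k - 1) := by
    rw [← pow_add]
    congr 1
    omega
  -- Replacing `y` by `-(lam / α) * x ^ k` in the mixed term produces the `x ^ (2 * k - 1)` term.
  have hdec : v - (β * x ^ n + lam ^ 2 * k / α * x ^ (2 * k - 1)) =
      (v - (β * x ^ n - lam * k * y * x ^ (k - 1))) -
        lam * k * x ^ (k - 1) * (y + lam / α * x ^ k) := by
    rw [← hkk]
    ring
  have hlast : |lam * k * x ^ (k - 1) * (y + lam / α * x ^ k)| ≤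
      |lam| * k * L * |x| ^ (2 * k) := by
    rw [abs_mul, abs_mul, abs_mul, abs_pow, Nat.abs_cast]
    calc |lam| * k * |x| ^ (k - 1) * |y + lam / α * x ^ k|
        ≤ |lam| * k * |x| ^ (k - 1) * (L * |x| ^ (k + 1)) := by gcongr
      _ = |lam| * k * L * (|x| ^ (k - 1) * |x| ^ (k + 1)) := by ring
      _ = _ := by
        rw [← pow_add]
        congr 2
        omega
  have hN : 0 ≤ |x| ^ (n + 1) := by positivity
  have h2k : 0 ≤ |x| ^ (2 * k) := by positivity
  have hfirst : C * (|x| ^ (n + 1) + |y| * |x| ^ k + |y| ^ 2) ≤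
      C * (1 + M + M ^ 2) * (|x| ^ (n + 1) + |x| ^ (2 * k)) := by
    rw [mul_assoc]
    gcongr
    nlinarith [mul_nonneg hM0.le hN, mul_nonneg (sq_nonneg M) hN]
  rw [hdec]
  refine (abs_sub _ _).trans ((add_le_add (h2.trans hfirst) hlast).trans ?_)
  have : 0 ≤ |lam| * k * L * |x| ^ (n + 1) := by positivity
  nlinarith [mul_nonneg hM0.le hN, mul_nonneg hM0.le h2k]

/-- If the second component is `c * x ^ m + O(|x| ^ (m + 1))` along the zero set of the first
one, then it has the sign of `c * x ^ m` there. -/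
theorem HasTaylorForm.sign_of_leading_term {u : Plane → Plane} {α β lam c : ℝ} {n k m : ℕ}
    (hu : HasTaylorForm u α β lam n k) (hα : α ≠ 0) (hk : 1 ≤ k) (hc : c ≠ 0)
    (hlead : ∃ A : ℝ, 0 ≤ A ∧ ∀ x : ℝ, |x| ≤ 1 →
      |β * x ^ n + lam ^ 2 * k / α * x ^ (2 * k - 1) - c * x ^ m| ≤ A * |x| ^ (m + 1))
    (hmn : m ≤ n) (hmk : m + 1 ≤ 2 * k) :
    ∀ᶠ p in 𝓝 (0 : Plane), p ≠ 0 → u p 0 = 0 → p 0 ≠ 0 ∧ 0 < c * p 0 ^ m * u p 1 := by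
  obtain ⟨K, hK, h⟩ := hu.exists_bound_of_eq_zero hα hk
  obtain ⟨A, hA, hlead⟩ := hlead
  have hc' := abs_pos.2 hc
  -- `K` counts twice because `|x| ^ (n + 1)` and `|x| ^ (2 * k)` are each at most `|x| ^ (m + 1)`.
  filter_upwards [h, Plane.eventually_abs_lt (ε := min 1 (|c| / (A + 2 * K))) (by positivity)]
    with p hp hsm hp0 hu0
  obtain ⟨hy, hv⟩ := hp hu0
  obtain ⟨hx1, hx2⟩ := lt_min_iff.1 hsm.1
  have hx0 : p 0 ≠ 0 := fun hx => hp0 <| Plane.eq_zero hx <| by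
    rw [hx, abs_zero, zero_pow (by omega), mul_zero] at hy
    exact abs_nonpos_iff.1 hy
  refine ⟨hx0, ?_⟩
  have hl := hlead (p 0) hx1.le
  generalize u p 1 = v at *
  generalize p 0 = x at *
  have hX := abs_nonneg x
  have hb : |v - c * x ^ m| ≤ (A + 2 * K) * |x| ^ (m + 1) := by
    have e1 : |x| ^ (n + 1) ≤ |x| ^ (m + 1) := pow_le_pow_of_le_one hX hx1.le (by omega)
    have e2 : |x| ^ (2 * k) ≤ |x| ^ (m + 1) := pow_le_pow_of_le_one hX hx1.le hmk
    have e3 := abs_sub_le v (β * x ^ n + lam ^ 2 * k / α * x ^ (2 * k - 1)) (c * x ^ m)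
    nlinarith
  rw [lt_div_iff₀ (by positivity)] at hx2
  have hpos : 0 < |x| ^ m := pow_pos (abs_pos.2 hx0) m
  have h3 : |v - c * x ^ m| < |c * x ^ m| := by
    rw [abs_mul, abs_pow]
    refine hb.trans_lt ?_
    rw [pow_succ]
    nlinarith
  have h4 := sq_lt_sq.2 h3
  nlinarith [sq_nonneg v]

/-! ### Index from the leading term -/

theorem HasTaylorForm.hasIndex_zero {u : Plane → Plane} {α β lam c : ℝ} {n k m : ℕ}
    (hu : HasTaylorForm u α β lam n k) (hcont : ∀ᶠ p in 𝓝 (0 : Plane), ContinuousAt u p)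
    (hα : α ≠ 0) (hn : 1 ≤ n) (hk : 1 ≤ k) (hc : c ≠ 0)
    (hlead : ∃ A : ℝ, 0 ≤ A ∧ ∀ x : ℝ, |x| ≤ 1 →
      |β * x ^ n + lam ^ 2 * k / α * x ^ (2 * k - 1) - c * x ^ m| ≤ A * |x| ^ (m + 1))
    (hmn : m ≤ n) (hmk : m + 1 ≤ 2 * k) (hm : Even m) : HasIndex u 0 0 := by
  refine hasIndex_zero_of_sign hc hcont (hu.map_zero (by omega) (by omega)) ?_
  filter_upwards [hu.sign_of_leading_term hα hk hc hlead hmn hmk] with p hp hp0 hu0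
  obtain ⟨hx, h⟩ := hp hp0 hu0
  have h1 : 0 < p 0 ^ m * (c * u p 1) := by linarith
  exact pos_of_mul_pos_right h1 (hm.pow_pos hx).le

theorem HasTaylorForm.hasIndex_of_odd {u : Plane → Plane} {α β lam c : ℝ} {n k m : ℕ} {d : ℤ}
    (hu : HasTaylorForm u α β lam n k) (hcont : ∀ᶠ p in 𝓝 (0 : Plane), ContinuousAt u p)
    (hn : 1 ≤ n) (hk : 1 ≤ k)
    (hlead : ∃ A : ℝ, 0 ≤ A ∧ ∀ x : ℝ, |x| ≤ 1 →
      |β * x ^ n + lam ^ 2 * k / α * x ^ (2 * k - 1) - c * x ^ m| ≤ A * |x| ^ (m + 1))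
    (hmn : m ≤ n) (hmk : m + 1 ≤ 2 * k) (hm : Odd m)
    (hd : (0 < α * c ∧ d = -1) ∨ (α * c < 0 ∧ d = 1)) : HasIndex u 0 d := by
  have hα : α ≠ 0 := by
    rintro rfl
    simp at hd
  have hc : c ≠ 0 := by
    rintro rfl
    simp at hd
  refine hasIndex_of_sign hcont (hu.map_zero (by omega) (by omega)) ?_
    (hu.sign_on_axis hα (by omega)) hd
  filter_upwards [hu.sign_of_leading_term hα hk hc hlead hmn hmk] with p hp hp0 hu0
  obtain ⟨hx, h⟩ := hp hp0 hu0
  obtain ⟨j, rfl⟩ := hm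
  have h1 : 0 < (p 0 ^ j) ^ 2 * (c * p 0 * u p 1) := by
    rw [pow_succ, pow_mul'] at h
    linarith
  exact pos_of_mul_pos_right h1 (sq_nonneg _)

theorem exists_bound_pow {b : ℝ} {m j : ℕ} (h : m + 1 ≤ j) :
    ∃ A : ℝ, 0 ≤ A ∧ ∀ x : ℝ, |x| ≤ 1 → |b * x ^ j| ≤ A * |x| ^ (m + 1) := by
  refine ⟨|b|, abs_nonneg b, fun x hx => ?_⟩
  rw [abs_mul, abs_pow]
  gcongr ?_ * ?_
  exact pow_le_pow_of_le_one (abs_nonneg x) hx h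

theorem lemma2p1 (u : Plane → Plane) (α β lam : ℝ) (n k : ℕ)
    (hα : α ≠ 0) (hβ : β ≠ 0) (hlam : lam ≠ 0) (hn : 2 ≤ n) (hk : 2 ≤ k)
    (hcont : ∀ᶠ p in 𝓝 (0 : Plane), ContinuousAt u p)
    (hu : HasTaylorForm u α β lam n k) :
    (2 * k > n + 1 → Even n → HasIndex u 0 0) ∧
    (2 * k > n + 1 → Odd n → α * β > 0 → HasIndex u 0 (-1)) ∧
    (2 * k > n + 1 → Odd n → α * β < 0 → HasIndex u 0 1) ∧
    (2 * k = n + 1 → lam ^ 2 * k + α * β > 0 → HasIndex u 0 (-1)) ∧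
    (2 * k = n + 1 → lam ^ 2 * k + α * β < 0 → HasIndex u 0 1) ∧
    (2 * k < n + 1 → HasIndex u 0 (-1)) := by
  have hn1 : 1 ≤ n := by omega
  have hk1 : 1 ≤ k := by omega
  have hodd : Odd (2 * k - 1) := ⟨k - 1, by omega⟩
  have hkpos : (0 : ℝ) < k := by positivity
  have hgt : 2 * k > n + 1 → ∃ A : ℝ, 0 ≤ A ∧ ∀ x : ℝ, |x| ≤ 1 →
      |β * x ^ n + lam ^ 2 * k / α * x ^ (2 * k - 1) - β * x ^ n| ≤ A * |x| ^ (n + 1) := by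
    intro h
    simp only [add_sub_cancel_left]
    exact exists_bound_pow (by omega)
  have heq : 2 * k = n + 1 → ∃ A : ℝ, 0 ≤ A ∧ ∀ x : ℝ, |x| ≤ 1 →
      |β * x ^ n + lam ^ 2 * k / α * x ^ (2 * k - 1) - (β + lam ^ 2 * k / α) * x ^ n| ≤
        A * |x| ^ (n + 1) := by
    intro h
    obtain rfl : n = 2 * k - 1 := by omega
    -- The two monomials coincide, so there is no remainder.
    exact ⟨0, le_rfl, fun x _ => by simp [add_mul]⟩
  have hlt : 2 * k < n + 1 → ∃ A : ℝ, 0 ≤ A ∧ ∀ x : ℝ, |x| ≤ 1 →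
      |β * x ^ n + lam ^ 2 * k / α * x ^ (2 * k - 1) - lam ^ 2 * k / α * x ^ (2 * k - 1)| ≤
        A * |x| ^ (2 * k - 1 + 1) := by
    intro h
    simp only [add_sub_cancel_right]
    exact exists_bound_pow (by omega)
  have hcoef : α * (β + lam ^ 2 * k / α) = lam ^ 2 * k + α * β := by
    field_simp
    ring
  refine ⟨fun h he => ?_, fun h ho hs => ?_, fun h ho hs => ?_, fun h hs => ?_, fun h hs => ?_,
    fun h => ?_⟩
  · exact hu.hasIndex_zero hcont hα hn1 hk1 hβ (hgt h) le_rfl (by omega) he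
  · exact hu.hasIndex_of_odd hcont hn1 hk1 (hgt h) le_rfl (by omega) ho (Or.inl ⟨hs, rfl⟩)
  · exact hu.hasIndex_of_odd hcont hn1 hk1 (hgt h) le_rfl (by omega) ho (Or.inr ⟨hs, rfl⟩)
  · exact hu.hasIndex_of_odd hcont hn1 hk1 (heq h) le_rfl (by omega) ⟨k - 1, by omega⟩
      (Or.inl ⟨by rwa [hcoef], rfl⟩)
  · exact hu.hasIndex_of_odd hcont hn1 hk1 (heq h) le_rfl (by omega) ⟨k - 1, by omega⟩
      (Or.inr ⟨by rwa [hcoef], rfl⟩)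
  · refine hu.hasIndex_of_odd hcont hn1 hk1 (hlt h) (by omega) (by omega) hodd
      (Or.inl ⟨?_, rfl⟩)
    -- Here `α * c = lam ^ 2 * k` is positive whatever the signs of `α` and `β`.
    rw [mul_div_cancel₀ _ hα]
    positivity
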